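/- **The random gadget.** For integers $m \ge p\ge 1$ and $d_{\rm in}, d_{\rm out}\ge 0$, let $\mathcal G(m,p,d_{\rm in},d_{\rm out})$ be the following random bipartite graph $G$ on $V_G = L\cup R$, where $L\cap R=\emptyset$ and $|L|=|R|=m$. Choose a set $P\subseteq V_G$ of *ports* uniformly at random among the sets with $|P\cap L|=|P\cap R|=p$; choose independent uniformly random perfect matchings, $d_{\rm in}$ of them between $L$ and $R$, and $d_{\rm out}$ of them between $L\setminus P$ and $R\setminus P$; let $G$ be the simple graph whose edge set is the union of all these matchings (multiple edges are replaced by single edges). Let $\sigma^+(G)$ be the configuration assigning $+$ to every vertex of $L$ and $-$ to every vertex of $R$, and let $\sigma^-(G)$ be its negation. **The Ising model.** For a finite graph $G'=(V',E')$ and $\beta\in\mathbb R$, let $\mu_{G',\beta}$ be the distribution on $\{+,-\}^{V'}$ with $\mu_{G',\beta}(\sigma) = e^{\beta A(\sigma)}/Z_{G',\beta}$, where $A(\sigma)$ is the number of edges of $G'$ whose endpoints have the same spin and $Z_{G',\beta}=\sum_\sigma e^{\beta A(\sigma)}$. **Admissible extensions.** Call a finite simple graph $G'$ an admissible extension of $G$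 if $G$ is an induced subgraph of $G'$ and, with $\partial P = V_{G'}\setminus V_G$, every vertex of $P$ has at most $d_{\rm out}$ neighbours in $\partial P$, and there are no edges between $V_G\setminus P$ and $\partial P$. **Theorem.** Let $\rho\in(0,1)$. There exist constants $\theta=\theta(\rho)\in(0,1)$ and $\delta=\delta(\rho)>0$ and a function $\varepsilon=\varepsilon_\rho:\mathbb N\to\mathbb R$ with $\varepsilon(m)\to 0$ as $m\to\infty$ such that the following holds for all integers $m,d$ with $4+\frac{1200}{\rho}\le d\le m^{1-\rho}$ and all $\beta<0$. Put $p=m$, $d_{\rm in}=\lfloor\theta d\rfloor$ and $d_{\rm out}=d-\lfloor\theta d\rfloor$. Then, with probability at least $1-\varepsilon(m)$ over the choice of $G\sim\mathcal G(m,p,d_{\rm in},d_{\rm out})$, for every admissible extension $G'$ of $G$ and every configuration $\tau\in\{+,-\}^{\partial P}$, $$\mu_{G',\beta}\bigl(\{\sigma^+(G),\sigma^-(G)\}\,\big|\,\partial P=\tau\bigr)\;\ge\;1-\frac{2m}{e^{\delta|\beta|d}},$$ where the left-hand side is the conditional probability, given that the configuration on $\partial P$ is $\tau$, that the configuration on $V_G$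 is $\sigma^+(G)$ or $\sigma^-(G)$. -/

import Mathlib

open MeasureTheory Filter Topology

namespace IsingGadget

/-! ### The Ising model on a finite graph

Spins are Booleans, `true` standing for `+` and `false` for `-`. -/

/-- `A(σ)`: the number of edges of `G` whose two endpoints have the same spin. -/
noncomputable def monoEdges {V : Type*} (G : SimpleGraph V) (σ : V → Bool) : ℕ :=
  {e : Sym2 V | e ∈ G.edgeSet ∧ (e.map σ).IsDiag}.ncard

/-- The weight `exp (β A(σ))` of a configuration. -/
noncomputable def weight {V : Type*} (G : SimpleGraph V) (β : ℝ) (σ : V → Bool) : ℝ :=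
  Real.exp (β * monoEdges G σ)

/-- The partition function `Z`. -/
noncomputable def partitionFunction {V : Type*} [Fintype V] [DecidableEq V]
    (G : SimpleGraph V) (β : ℝ) : ℝ :=
  ∑ σ : V → Bool, weight G β σ

/-- The Gibbs distribution, giving mass `exp (β A(σ)) / Z` to each configuration `σ`. -/
noncomputable def isingMeasure {V : Type*} [Fintype V] [DecidableEq V]
    (G : SimpleGraph V) (β : ℝ) : Measure (V → Bool) :=
  ∑ σ : V → Bool, ENNReal.ofReal (weight G β σ / partitionFunction G β) • Measure.dirac σ

/-! ### The random bipartite graph -/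

/-- The vertex set `L ∪ R`, with `L` the left and `R` the right copy of `Fin m`. -/
abbrev GadgetVertex (m : ℕ) : Type := Fin m ⊕ Fin m

/-- The possible sets of ports: `p` vertices in `L` and `p` vertices in `R`. -/
abbrev PortSet (m p : ℕ) : Type :=
  {P : Finset (GadgetVertex m) // P.toLeft.card = p ∧ P.toRight.card = p}

/-- The random choices behind the gadget: a set `P` of ports, `dIn` perfect matchings between `L`
and `R`, and `dOut` perfect matchings between `L \ P` and `R \ P`. -/
def GadgetSample (m p dIn dOut : ℕ) : Type :=
  Σ P : PortSet m p,
    (Fin dIn → (Fin m ≃ Fin m)) ×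
    (Fin dOut → ({i : Fin m // Sum.inl i ∉ P.1} ≃ {j : Fin m // Sum.inr j ∉ P.1}))

noncomputable instance (m p dIn dOut : ℕ) : Fintype (GadgetSample m p dIn dOut) :=
  inferInstanceAs (Fintype (Σ P : PortSet m p,
    (Fin dIn → (Fin m ≃ Fin m)) ×
    (Fin dOut → ({i : Fin m // Sum.inl i ∉ P.1} ≃ {j : Fin m // Sum.inr j ∉ P.1}))))

instance (m p dIn dOut : ℕ) : MeasurableSpace (GadgetSample m p dIn dOut) := ⊤

/-- The uniform distribution on the random choices. The number of choices of the matchings is the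
same for every `P`, so under it `P` is uniform and, given `P`, all the matchings are independent
and uniform. It is a probability measure as soon as `p ≤ m`. -/
noncomputable def gadgetMeasure (m p dIn dOut : ℕ) : Measure (GadgetSample m p dIn dOut) :=
  ProbabilityTheory.uniformOn Set.univ

/-- The set of ports. -/
def GadgetSample.ports {m p dIn dOut : ℕ} (ω : GadgetSample m p dIn dOut) :
    Finset (GadgetVertex m) :=
  ω.1.1

/-- The edges of the first family of matchings. -/
def GadgetSample.innerEdges {m p dIn dOut : ℕ} (ω : GadgetSample m p dIn dOut) :
    Set (Sym2 (GadgetVertex m)) :=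
  ⋃ k : Fin dIn, Set.range fun i : Fin m => s(Sum.inl i, Sum.inr (ω.2.1 k i))

/-- The edges of the second family of matchings, between non-ports. -/
def GadgetSample.outerEdges {m p dIn dOut : ℕ} (ω : GadgetSample m p dIn dOut) :
    Set (Sym2 (GadgetVertex m)) :=
  ⋃ k : Fin dOut, Set.range fun i : {i : Fin m // Sum.inl i ∉ ω.1.1} =>
    s(Sum.inl i.1, Sum.inr (ω.2.2 k i).1)

/-- The random (simple) graph `G`, the union of all the matchings. -/
def GadgetSample.graph {m p dIn dOut : ℕ} (ω : GadgetSample m p dIn dOut) :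
    SimpleGraph (GadgetVertex m) :=
  SimpleGraph.fromEdgeSet (ω.innerEdges ∪ ω.outerEdges)

/-! ### Phases and boundary conditions -/

/-- The configuration `σ⁺(G)`: `+` on `L` and `-` on `R`. -/
def plusPhase (m : ℕ) : GadgetVertex m → Bool := Sum.elim (fun _ => true) (fun _ => false)

/-- The configuration `σ⁻(G)`: `-` on `L` and `+` on `R`. -/
def minusPhase (m : ℕ) : GadgetVertex m → Bool := Sum.elim (fun _ => false) (fun _ => true)

/-- `G'` is a graph on `V ∪ B`, where `B = ∂P` is disjoint from `V`, in which `G` is an induced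
subgraph, each vertex of `P` has at most `dOut` neighbours in `B`, and there are no edges between
`V \ P` and `B`. -/
structure IsExtension {V B : Type*} (G : SimpleGraph V) (P : Finset V) (dOut : ℕ)
    (G' : SimpleGraph (V ⊕ B)) : Prop where
  induced : G'.comap Sum.inl = G
  port_degree : ∀ v ∈ P, {b : B | G'.Adj (Sum.inl v) (Sum.inr b)}.encard ≤ dOut
  nonport : ∀ v ∉ P, ∀ b : B, ¬ G'.Adj (Sum.inl v) (Sum.inr b)

/-- The event `{∂P = τ}`. -/
def boundaryEvent {V B : Type*} (τ : B → Bool) : Set (V ⊕ B → Bool) :=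
  {η | ∀ b, η (Sum.inr b) = τ b}

/-- The event that the configuration on the gadget is one of the two phases. -/
def phaseEvent (m : ℕ) (B : Type*) : Set (GadgetVertex m ⊕ B → Bool) :=
  {η | (fun v => η (Sum.inl v)) = plusPhase m ∨ (fun v => η (Sum.inl v)) = minusPhase m}

/-- For all the finite graphs `G'` extending `G` through its ports and all the configurations `τ`
on `∂P`, the conditional probability of the two phases given `∂P = τ` is at least `q`. -/
def PhasesLikely {m : ℕ} (G : SimpleGraph (GadgetVertex m)) (P : Finset (GadgetVertex m))
    (dOut : ℕ) (β q : ℝ) : Prop :=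
  ∀ (B : Type) [Fintype B] [DecidableEq B] (G' : SimpleGraph (GadgetVertex m ⊕ B)),
    IsExtension G P dOut G' → ∀ τ : B → Bool,
      q ≤ (ProbabilityTheory.cond (isingMeasure G' β) (boundaryEvent τ)).real (phaseEvent m B)

end IsingGadget

/-! # Why the two phases dominate

As all the vertices are ports, the gadget is the union of `D = ⌊θ d⌋` independent random perfect
matchings. Let `κ` be a lower bound for the number of edges of the gadget that leave a set `S` of at
most half of the vertices, per vertex of `S`. Flipping one of the two phases on `S` makes all these
edges monochromatic, and removes at most `d - D` monochromatic edges per vertex of `S`, those towards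
the boundary `∂P`. So, if `κ ≥ d - D + lam`, a configuration at distance `s` from the nearer phase has
at most `exp (-s * lam * |β|)` times the weight of that phase, and the sum over all configurations is
dominated by the two phases (`phasesLikely_of_edgeBoundary`). As `θ` may be taken close to `1`, with
`d - D` at most `ρ d / 600`, it is enough that `κ` is a slightly larger multiple of `ρ d`.

Let `A` be the left and `B` the right part of `S`, with `|B| ≤ |A|` without loss of generality. It
remains to show that there are at least `(ρ d / 200) |A|` distinct edges from `A` to the outside of `B`.
For one pair `A`, `B` this follows from an exponential moment bound (`card_crossing_le`): the matchings
are exposed one by one, and as long as few edges out of `A` leave `B`, the next matching is likely to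
produce new ones (`sum_pow_card_union_le`). Repeated edges need no separate treatment, since only new
edges are counted. For the union bound, `A` may be taken of size at most `m / 8`. If it has exactly this
size, there are at most `4 ^ m` pairs and the bound for each of them is exponentially small in `d * m`
(`card_large_crossing_le`). If it is smaller, a bound that is a power of `(|A| + ρ d / 200) / m` is
needed; the hypotheses `d ≤ m ^ (1 - ρ)` and `d ≥ 1200 / ρ` make it small enough
(`small_set_estimate`, `card_small_crossing_le`). The total failure probability is at most `4 / m`.
-/

namespace IsingGadget

/-! ### From edge expansion to the Gibbs measure -/

/-- The edge boundary of `S`: the edges of `G` with exactly one endpoint in `S`, each recorded once,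
as the ordered pair whose first component is the endpoint in `S`. -/
def edgeBoundary {V : Type*} (G : SimpleGraph V) (S : Finset V) : Set (V × V) :=
  {p | p.1 ∈ S ∧ p.2 ∉ S ∧ G.Adj p.1 p.2}

/-- Flipping a proper two-colouring `c` on `S` makes every boundary edge of `S` monochromatic, and the
only monochromatic edges that it can destroy join `S` to the outside of the gadget; there are at
most `k` of those at each vertex. -/
theorem IsExtension.monoEdges_add_le {V B : Type*} [Fintype V] [Fintype B]
    {G : SimpleGraph V} {P : Finset V} {k : ℕ} {G' : SimpleGraph (V ⊕ B)}
    (h : IsExtension G P k G') {c : V → Bool} (hc : ∀ u v, G.Adj u v → c u ≠ c v)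
    (σ : V → Bool) (τ : B → Bool) {S : Finset V} (hS : ∀ v, v ∈ S ↔ σ v ≠ c v) :
    monoEdges G' (Sum.elim c τ) + (edgeBoundary G S).ncard
      ≤ monoEdges G' (Sum.elim σ τ) + k * S.card := by
  classical
  have hadj : ∀ u v, G'.Adj (Sum.inl u) (Sum.inl v) ↔ G.Adj u v := by
    intro u v
    rw [← h.induced]
    rfl
  have hdeg : ∀ v, {b : B | G'.Adj (Sum.inl v) (Sum.inr b)}.ncard ≤ k := by
    intro v
    by_cases hv : v ∈ P
    · have := h.port_degree v hv
      rw [← Set.Finite.cast_ncard_eq (Set.toFinite _)] at this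
      exact_mod_cast this
    · have : {b : B | G'.Adj (Sum.inl v) (Sum.inr b)} = ∅ := by
        ext b
        simpa using h.nonport v hv b
      simp [this]
  unfold monoEdges
  -- `M₀` and `M` are the sets of monochromatic edges under the colouring and after the flip.
  set M₀ : Set (Sym2 (V ⊕ B)) := {e | e ∈ G'.edgeSet ∧ (e.map (Sum.elim c τ)).IsDiag} with hM₀
  set M : Set (Sym2 (V ⊕ B)) := {e | e ∈ G'.edgeSet ∧ (e.map (Sum.elim σ τ)).IsDiag} with hM
  have h1 : (edgeBoundary G S).ncard ≤ (M \ M₀).ncard := by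
    refine Set.ncard_le_ncard_of_injOn (fun p => s(Sum.inl p.1, Sum.inl p.2)) ?_ ?_
      (Set.toFinite _)
    · rintro ⟨u, v⟩ ⟨hu, hv, huv⟩
      have huv' := hc u v huv
      simp only [hS] at hu hv
      simp only [hM, hM₀, Set.mem_sdiff, Set.mem_ofPred_eq, SimpleGraph.mem_edgeSet, hadj, huv,
        Sym2.map_mk, Sym2.mk_isDiag_iff, Sum.elim_inl, true_and]
      refine ⟨?_, huv'⟩
      revert hu hv huv'
      cases σ u <;> cases σ v <;> cases c u <;> cases c v <;> simp
    · rintro ⟨u, v⟩ ⟨hu, hv, -⟩ ⟨u', v'⟩ ⟨hu', hv', -⟩ heq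
      simp only [Sym2.eq_iff, Sum.inl.injEq] at heq
      rcases heq with ⟨rfl, rfl⟩ | ⟨rfl, rfl⟩
      · rfl
      · exact absurd hu hv'
  have h2 : (M₀ \ M).ncard ≤ k * S.card := by
    have hsub : M₀ \ M ⊆ ⋃ v ∈ S, (fun b => s(Sum.inl v, Sum.inr b)) ''
        {b : B | G'.Adj (Sum.inl v) (Sum.inr b)} := by
      have key : ∀ u b, G'.Adj (Sum.inl u) (Sum.inr b) → c u = τ b → σ u ≠ τ b →
          s(Sum.inl u, Sum.inr b) ∈ ⋃ v ∈ S, (fun b => s(Sum.inl v, Sum.inr b)) ''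
            {b : B | G'.Adj (Sum.inl v) (Sum.inr b)} := by
        intro u b hub hcu hsu
        simp only [Set.mem_iUnion]
        refine ⟨u, (hS u).2 (by rw [hcu]; exact hsu), b, hub, rfl⟩
      intro e
      induction e with | _ x y
      simp only [hM, hM₀, Set.mem_sdiff, Set.mem_ofPred_eq, SimpleGraph.mem_edgeSet,
        Sym2.map_mk, Sym2.mk_isDiag_iff]
      rintro ⟨⟨hxy, hd⟩, hn⟩
      replace hn : Sum.elim σ τ x ≠ Sum.elim σ τ y := fun h => hn ⟨hxy, h⟩
      rcases x with u | a <;> rcases y with v | b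
      · exact absurd hd (hc u v ((hadj u v).1 hxy))
      · exact key u b hxy hd hn
      · rw [Sym2.eq_swap]
        exact key v a hxy.symm hd.symm hn.symm
      · exact absurd hd hn
    calc (M₀ \ M).ncard ≤ _ := Set.ncard_le_ncard hsub (Set.toFinite _)
      _ ≤ ∑ v ∈ S, ((fun b => s(Sum.inl v, Sum.inr b)) ''
            {b : B | G'.Adj (Sum.inl v) (Sum.inr b)}).ncard := Finset.set_ncard_biUnion_le _ _
      _ ≤ ∑ v ∈ S, k := Finset.sum_le_sum fun v _ =>
            (Set.ncard_image_le (Set.toFinite _)).trans (hdeg v)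
      _ = k * S.card := by simp [mul_comm]
  have h3 := Set.ncard_sdiff_add_ncard M₀ M
  have h4 := Set.ncard_sdiff_add_ncard M M₀
  rw [Set.union_comm] at h4
  omega

theorem sum_pow_card_disagree {V : Type*} [Fintype V] [DecidableEq V] (c : V → Bool) (x : ℝ) :
    ∑ σ : V → Bool, x ^ (Finset.univ.filter fun v => σ v ≠ c v).card
      = (1 + x) ^ Fintype.card V := by
  have h := Finset.prod_univ_sum (fun _ : V => (Finset.univ : Finset Bool))
    (fun v b => if b ≠ c v then x else 1)
  rw [Fintype.piFinset_univ] at h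
  have h1 : ∀ v : V, (∑ b : Bool, if b ≠ c v then x else 1) = 1 + x := by
    intro v
    rw [Fintype.sum_bool]
    cases c v <;> simp [add_comm]
  simp only [h1, Finset.prod_const, Finset.card_univ] at h
  rw [h]
  refine Finset.sum_congr rfl fun σ _ => ?_
  rw [Finset.prod_ite]
  simp

theorem isingMeasure_real_apply {V : Type*} [Fintype V] [DecidableEq V] (G : SimpleGraph V)
    (β : ℝ) (s : Set (V → Bool)) [DecidablePred (· ∈ s)] :
    (isingMeasure G β).real s
      = (∑ σ ∈ Finset.univ.filter (· ∈ s), weight G β σ) / partitionFunction G β := by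
  have hs : MeasurableSet s := (Set.toFinite s).measurableSet
  have hpos : ∀ σ, 0 ≤ weight G β σ / partitionFunction G β := fun σ =>
    div_nonneg (Real.exp_pos _).le (Finset.sum_nonneg fun _ _ => (Real.exp_pos _).le)
  rw [Measure.real, isingMeasure, Measure.finsetSum_apply,
    ENNReal.toReal_sum (fun σ _ => by
      rw [Measure.smul_apply, smul_eq_mul]
      exact (ENNReal.mul_lt_top ENNReal.ofReal_lt_top (measure_lt_top _ _)).ne),
    Finset.sum_div, Finset.sum_filter]
  refine Finset.sum_congr rfl fun σ _ => ?_
  rw [Measure.smul_apply, Measure.dirac_apply' _ hs, smul_eq_mul, ENNReal.toReal_mul,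
    ENNReal.toReal_ofReal (hpos σ)]
  by_cases h : σ ∈ s <;> simp [h]

theorem sum_boundaryEvent {V B : Type*} [Fintype V] [Fintype B] [DecidableEq V] [DecidableEq B]
    (τ : B → Bool) (f : (V ⊕ B → Bool) → ℝ) (p : (V → Bool) → Prop) [DecidablePred p]
    [DecidablePred (· ∈ boundaryEvent (V := V) τ ∩ {η | p fun v => η (Sum.inl v)})] :
    ∑ η ∈ Finset.univ.filter (· ∈ boundaryEvent τ ∩ {η | p fun v => η (Sum.inl v)}), f η
      = ∑ σ ∈ Finset.univ.filter p, f (Sum.elim σ τ) := by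
  symm
  refine Finset.sum_nbij' (fun σ => Sum.elim σ τ) (fun η v => η (Sum.inl v)) ?_ ?_ ?_ ?_ ?_
  · intro σ hσ
    simpa [boundaryEvent] using hσ
  · intro η hη
    simp only [Finset.mem_filter, Finset.mem_univ, true_and, Set.mem_inter_iff,
      Set.mem_ofPred_eq] at hη ⊢
    exact hη.2
  · intro σ _
    rfl
  · intro η hη
    simp only [Finset.mem_filter, Finset.mem_univ, true_and, Set.mem_inter_iff, boundaryEvent,
      Set.mem_ofPred_eq] at hη
    ext x
    rcases x with v | b
    · rfl
    · exact (hη.1 b).symm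
  · intro σ _
    rfl

theorem one_add_sq_pow_le {n : ℕ} (hn : 2 ≤ n) {y : ℝ} (hy0 : 0 ≤ y) (hy : n * y ≤ 1) :
    (1 + y ^ 2) ^ n ≤ 1 + n * y := by
  have hn' : (2 : ℝ) ≤ n := by exact_mod_cast hn
  have hy2 : y ≤ 1 / 2 := by nlinarith
  have hu0 : 0 ≤ n * y ^ 2 := by positivity
  have hu : (n : ℝ) * y ^ 2 ≤ 1 / 2 := by nlinarith
  have h1 : (1 + y ^ 2) ^ n ≤ Real.exp (n * y ^ 2) := by
    rw [Real.exp_nat_mul]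
    exact pow_le_pow_left₀ (by positivity) (by linarith [Real.add_one_le_exp (y ^ 2)]) _
  have h2 : Real.exp (n * y ^ 2) ≤ 1 / (1 - n * y ^ 2) := by
    rw [le_div_iff₀ (by linarith)]
    have := Real.add_one_le_exp (-(n * y ^ 2))
    calc _ ≤ Real.exp (n * y ^ 2) * Real.exp (-(n * y ^ 2)) := by
          gcongr; linarith
      _ = 1 := by rw [← Real.exp_add]; simp
  have h3 : 1 / (1 - n * y ^ 2) ≤ 1 + 2 * (n * y ^ 2) := by
    rw [div_le_iff₀ (by linarith)]
    nlinarith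
  have h4 : 2 * (n * y ^ 2) ≤ n * y := by
    nlinarith [mul_nonneg (Nat.cast_nonneg (α := ℝ) n) hy0]
  linarith

/-- If every nonempty set of at most half of the vertices has edge boundary at least `k + lam` per
vertex, where `k` bounds the number of outside neighbours, then a configuration that disagrees with
the nearer phase on `s` vertices is lighter than it by a factor `exp (-s * lam * |β|)`, whatever the
boundary condition. Summing over the sets of disagreement gives `(1 + exp (-lam * |β|)) ^ (2 * m)`
times the weight of the two phases. -/
theorem phasesLikely_of_edgeBoundary {m : ℕ} (hm : 0 < m) {G : SimpleGraph (GadgetVertex m)}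
    (P : Finset (GadgetVertex m)) {k : ℕ} {β lam : ℝ} (hβ : β < 0)
    (hG : ∀ u v, G.Adj u v → plusPhase m u ≠ plusPhase m v)
    (hexp : ∀ S : Finset (GadgetVertex m), S.Nonempty → S.card ≤ m →
      (k + lam) * S.card ≤ (edgeBoundary G S).ncard) :
    PhasesLikely G P k β (1 - 2 * m / Real.exp (lam / 2 * |β|)) := by
  classical
  intro B _ _ G' hG' τ
  have hneg : ∀ v, minusPhase m v = !plusPhase m v := by rintro (v | v) <;> rfl
  have hG₂ : ∀ u v, G.Adj u v → minusPhase m u ≠ minusPhase m v := by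
    intro u v huv
    rw [hneg, hneg]
    simpa using hG u v huv
  -- `y` is the square root of the cost `exp (-lam * |β|)` of one vertex of disagreement.
  set y : ℝ := Real.exp (-(lam / 2 * |β|)) with hy
  have hy0 : 0 < y := Real.exp_pos _
  have hyy : 2 * m / Real.exp (lam / 2 * |β|) = (2 * m : ℕ) * y := by
    rw [hy, Real.exp_neg]; push_cast; ring
  rw [hyy]
  set w : (GadgetVertex m → Bool) → ℝ := fun σ => weight G' β (Sum.elim σ τ) with hw
  have hwpos : ∀ σ, 0 < w σ := fun σ => Real.exp_pos _
  have hcmp : ∀ c : GadgetVertex m → Bool, (∀ u v, G.Adj u v → c u ≠ c v) →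
      ∀ σ, (Finset.univ.filter fun v => σ v ≠ c v).card ≤ m →
        w σ ≤ w c * (y ^ 2) ^ (Finset.univ.filter fun v => σ v ≠ c v).card := by
    intro c hc σ hσ
    set S := Finset.univ.filter fun v => σ v ≠ c v with hS
    rcases S.eq_empty_or_nonempty with h0 | h0
    · have : σ = c := by
        ext v
        by_contra hv
        have : v ∈ S := by simpa [hS] using hv
        simp [h0] at this
      rw [h0, this]; simp
    · have h1 := hG'.monoEdges_add_le hc σ τ (S := S) (by simp [hS])
      have h2 := hexp S h0 hσ
      have h1' : (monoEdges G' (Sum.elim c τ) : ℝ) + (edgeBoundary G S).ncard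
          ≤ monoEdges G' (Sum.elim σ τ) + k * S.card := by exact_mod_cast h1
      have h3 : (monoEdges G' (Sum.elim c τ) : ℝ) + lam * S.card
          ≤ monoEdges G' (Sum.elim σ τ) := by linarith
      have h4 : (y ^ 2) ^ S.card = Real.exp (β * (lam * S.card)) := by
        rw [hy, ← pow_mul, ← Real.exp_nat_mul, abs_of_neg hβ]
        congr 1; push_cast; ring
      rw [h4, hw]
      simp only [weight]
      rw [← Real.exp_add, Real.exp_le_exp, ← mul_add]
      exact mul_le_mul_of_nonpos_left h3 hβ.le
  -- The sets of disagreement with the two phases are complementary, so one has at most `m` elements.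
  have hall : ∀ σ, w σ
      ≤ w (plusPhase m) * (y ^ 2) ^ (Finset.univ.filter fun v => σ v ≠ plusPhase m v).card
      + w (minusPhase m) * (y ^ 2) ^ (Finset.univ.filter fun v => σ v ≠ minusPhase m v).card := by
    intro σ
    by_cases h : (Finset.univ.filter fun v => σ v ≠ plusPhase m v).card ≤ m
    · have h1 := hcmp _ hG σ h
      have : 0 ≤ w (minusPhase m) *
          (y ^ 2) ^ (Finset.univ.filter fun v => σ v ≠ minusPhase m v).card :=
        mul_nonneg (hwpos _).le (by positivity)
      linarith
    · have h5 := Finset.card_filter_add_card_filter_not (s := Finset.univ)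
        (fun v => σ v ≠ plusPhase m v)
      have h6 : (Finset.univ.filter fun v => ¬ (σ v ≠ plusPhase m v))
          = Finset.univ.filter fun v => σ v ≠ minusPhase m v := by
        ext v
        simp only [Finset.mem_filter, Finset.mem_univ, true_and, hneg]
        cases σ v <;> cases plusPhase m v <;> simp
      rw [h6] at h5
      simp only [Finset.card_univ, Fintype.card_sum, Fintype.card_fin] at h5
      have h1 := hcmp _ hG₂ σ (by omega)
      have : 0 ≤ w (plusPhase m) *
          (y ^ 2) ^ (Finset.univ.filter fun v => σ v ≠ plusPhase m v).card :=
        mul_nonneg (hwpos _).le (by positivity)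
      linarith
  have hsum : ∑ σ, w σ ≤ (w (plusPhase m) + w (minusPhase m)) * (1 + y ^ 2) ^ (2 * m) := by
    refine (Finset.sum_le_sum fun σ _ => hall σ).trans_eq ?_
    rw [Finset.sum_add_distrib, ← Finset.mul_sum, ← Finset.mul_sum, sum_pow_card_disagree,
      sum_pow_card_disagree]
    simp only [Fintype.card_sum, Fintype.card_fin]
    rw [← two_mul]; ring
  have hZ : 0 < partitionFunction G' β :=
    Finset.sum_pos (fun _ _ => Real.exp_pos _) Finset.univ_nonempty
  have hmeasE : MeasurableSet (boundaryEvent (V := GadgetVertex m) τ) :=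
    (Set.toFinite _).measurableSet
  have hE : (isingMeasure G' β).real (boundaryEvent τ) = (∑ σ, w σ) / partitionFunction G' β := by
    have h := sum_boundaryEvent (V := GadgetVertex m) τ (weight G' β) (fun _ => True)
    have : boundaryEvent (V := GadgetVertex m) τ ∩ {η | True} = boundaryEvent τ := by
      simp
    rw [← this, isingMeasure_real_apply, h]
    simp [hw]
  have hEF : (isingMeasure G' β).real (boundaryEvent τ ∩ phaseEvent m B)
      = (w (plusPhase m) + w (minusPhase m)) / partitionFunction G' β := by
    have h := sum_boundaryEvent (V := GadgetVertex m) τ (weight G' β)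
      (fun σ => σ = plusPhase m ∨ σ = minusPhase m)
    rw [phaseEvent, isingMeasure_real_apply, h]
    have hne : plusPhase m ≠ minusPhase m := fun h => by
      have := congrFun h (Sum.inl ⟨0, hm⟩)
      simp [plusPhase, minusPhase] at this
    have : (Finset.univ.filter fun σ => σ = plusPhase m ∨ σ = minusPhase m)
        = {plusPhase m, minusPhase m} := by
      ext σ; simp
    rw [this, Finset.sum_pair hne]
  have hp0 : 0 < w (plusPhase m) + w (minusPhase m) := add_pos (hwpos _) (hwpos _)
  have hsum0 : 0 < ∑ σ, w σ := Finset.sum_pos (fun _ _ => hwpos _) Finset.univ_nonempty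
  have hcond : (ProbabilityTheory.cond (isingMeasure G' β) (boundaryEvent τ)).real (phaseEvent m B)
      = ((isingMeasure G' β).real (boundaryEvent τ))⁻¹ *
        (isingMeasure G' β).real (boundaryEvent τ ∩ phaseEvent m B) := by
    rw [Measure.real, ProbabilityTheory.cond_apply hmeasE, ENNReal.toReal_mul, ENNReal.toReal_inv]
    rfl
  rw [hcond, hE, hEF]
  have hfin : ((∑ σ, w σ) / partitionFunction G' β)⁻¹ *
      ((w (plusPhase m) + w (minusPhase m)) / partitionFunction G' β)
      = (w (plusPhase m) + w (minusPhase m)) / ∑ σ, w σ := by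
    field_simp
  rw [hfin]
  rcases le_or_gt ((2 * m : ℕ) * y) 1 with h1 | h1
  · have hpow := one_add_sq_pow_le (n := 2 * m) (by omega) hy0.le h1
    have hny : 0 ≤ (2 * m : ℕ) * y := by positivity
    rw [le_div_iff₀ hsum0]
    calc (1 - (2 * m : ℕ) * y) * ∑ σ, w σ
        ≤ (1 - (2 * m : ℕ) * y) *
          ((w (plusPhase m) + w (minusPhase m)) * (1 + (2 * m : ℕ) * y)) := by
          refine mul_le_mul_of_nonneg_left (hsum.trans ?_) (by linarith)
          exact mul_le_mul_of_nonneg_left hpow hp0.le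
      _ = (w (plusPhase m) + w (minusPhase m)) * (1 - ((2 * m : ℕ) * y) ^ 2) := by ring
      _ ≤ w (plusPhase m) + w (minusPhase m) := by
          nlinarith [sq_nonneg (((2 * m : ℕ) : ℝ) * y)]
  -- Otherwise the claimed lower bound is negative.
  · have : 0 ≤ (w (plusPhase m) + w (minusPhase m)) / ∑ σ, w σ := by positivity
    linarith

/-! ### Edges of a random union of matchings -/

open Finset in
/-- A bound for the expectation of a product of row weights over the graph of a random permutation.
Adding a row `a` to `A` costs a factor `(∑ j, w a j) / (m - |A|)`: composing `π` with the transposition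
of `a` and some `l ∉ A` does not affect the rows in `A`, so `w a (π a)` may be replaced by its average
over the `m - |A|` values `w a (π l)`. -/
theorem sum_perm_prod_le {m M : ℕ} (hM : 0 < M) (A : Finset (Fin m)) (hA : A.card + M ≤ m)
    (w : Fin m → Fin m → ℝ) (hw : ∀ i j, 0 ≤ w i j) :
    ∑ π : Equiv.Perm (Fin m), ∏ i ∈ A, w i (π i)
      ≤ m.factorial * ∏ i ∈ A, ((∑ j, w i j) / M) := by
  classical
  induction A using Finset.induction_on with
  | empty => simp [Fintype.card_perm]
  | insert a A ha ih =>
    rw [card_insert_of_notMem ha] at hA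
    have ih := ih (by omega)
    have hM' : (0 : ℝ) < M := by exact_mod_cast hM
    have hr : 0 ≤ ∑ j, w a j := sum_nonneg fun j _ => hw a j
    have hF : ∀ π : Equiv.Perm (Fin m), 0 ≤ ∏ i ∈ A, w i (π i) := fun π =>
      prod_nonneg fun i _ => hw _ _
    have hswap : ∀ l ∈ Aᶜ, ∑ π : Equiv.Perm (Fin m), ∏ i ∈ insert a A, w i (π i)
        = ∑ π : Equiv.Perm (Fin m), (∏ i ∈ A, w i (π i)) * w a (π l) := by
      intro l hl
      refine Fintype.sum_equiv (Equiv.mulRight (Equiv.swap a l)) _ _ fun π => ?_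
      rw [prod_insert ha, mul_comm]
      congr 1
      · refine prod_congr rfl fun i hi => ?_
        have h1 : i ≠ a := fun h => ha (h ▸ hi)
        have h2 : i ≠ l := fun h => (mem_compl.1 hl) (h ▸ hi)
        simp [Equiv.swap_apply_of_ne_of_ne h1 h2]
      · simp
    have h1 : (Aᶜ.card : ℝ) * ∑ π : Equiv.Perm (Fin m), ∏ i ∈ insert a A, w i (π i)
        ≤ (∑ π : Equiv.Perm (Fin m), ∏ i ∈ A, w i (π i)) * ∑ j, w a j := by
      calc _ = ∑ l ∈ Aᶜ, ∑ π : Equiv.Perm (Fin m), (∏ i ∈ A, w i (π i)) * w a (π l) := by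
            rw [← sum_congr rfl hswap, sum_const, nsmul_eq_mul]
        _ = ∑ π : Equiv.Perm (Fin m), (∏ i ∈ A, w i (π i)) * ∑ l ∈ Aᶜ, w a (π l) := by
            rw [sum_comm]
            exact sum_congr rfl fun π _ => (mul_sum _ _ _).symm
        _ ≤ ∑ π : Equiv.Perm (Fin m), (∏ i ∈ A, w i (π i)) * ∑ j, w a j := by
            refine sum_le_sum fun π _ => mul_le_mul_of_nonneg_left ?_ (hF π)
            rw [← Equiv.sum_comp π (fun j => w a j)]
            exact sum_le_sum_of_subset_of_nonneg (subset_univ _) fun _ _ _ => hw _ _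
        _ = _ := (sum_mul _ _ _).symm
    have h2 : (M : ℝ) ≤ Aᶜ.card := by
      rw [card_compl, Fintype.card_fin]
      exact_mod_cast (by omega : M ≤ m - A.card)
    have h3 : 0 ≤ ∑ π : Equiv.Perm (Fin m), ∏ i ∈ insert a A, w i (π i) :=
      sum_nonneg fun π _ => prod_nonneg fun i _ => hw _ _
    rw [prod_insert ha]
    calc ∑ π : Equiv.Perm (Fin m), ∏ i ∈ insert a A, w i (π i)
        ≤ ((∑ π : Equiv.Perm (Fin m), ∏ i ∈ A, w i (π i)) * ∑ j, w a j) / M := by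
          rw [le_div_iff₀ hM', mul_comm]
          exact (mul_le_mul_of_nonneg_right h2 h3).trans h1
      _ ≤ ((m.factorial * ∏ i ∈ A, ((∑ j, w i j) / M)) * ∑ j, w a j) / M := by gcongr
      _ = _ := by ring

open Finset in
/-- The inequality of arithmetic and geometric means, from `x ≤ q * exp (x / q - 1)`. -/
theorem prod_le_mean_pow {ι : Type*} (A : Finset ι) (r : ι → ℝ) (hr : ∀ i ∈ A, 0 ≤ r i) {q : ℝ}
    (hq : 0 < q) (h : ∑ i ∈ A, r i ≤ A.card * q) : ∏ i ∈ A, r i ≤ q ^ A.card := by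
  calc ∏ i ∈ A, r i ≤ ∏ i ∈ A, q * Real.exp (r i / q - 1) := by
        refine prod_le_prod hr fun i _ => ?_
        have := Real.add_one_le_exp (r i / q - 1)
        calc r i = q * (r i / q) := by field_simp
          _ ≤ _ := by gcongr; linarith
    _ = q ^ A.card * Real.exp ((∑ i ∈ A, r i) / q - A.card) := by
        rw [prod_mul_distrib, prod_const, ← Real.exp_sum, sum_sub_distrib, sum_div]
        simp
    _ ≤ q ^ A.card * 1 := by
        gcongr
        rw [Real.exp_le_one_iff, sub_nonpos, div_le_iff₀ hq]
        exact h
    _ = _ := mul_one _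

/-- The part over `A` of the graph of `π`. -/
def graphOn {m : ℕ} (A : Finset (Fin m)) (π : Equiv.Perm (Fin m)) : Finset (Fin m × Fin m) :=
  A.image fun i => (i, π i)

/-- The set of edges at `A` of the union of the matchings `ω`, an edge being a pair of a left and a
right vertex. An edge that occurs in several matchings counts once. -/
def coveredBy {m D : ℕ} (A : Finset (Fin m)) (ω : Fin D → Equiv.Perm (Fin m)) :
    Finset (Fin m × Fin m) :=
  Finset.univ.biUnion fun k => graphOn A (ω k)

open Finset in
/-- One more random matching multiplies the expectation of `z` to the number of edges by at most
`q ^ |A|`: an edge at `i ∈ A` contributes `1` if it is already in `T`, and `z` if it is new. -/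
theorem sum_pow_card_union_le {m M : ℕ} (hM : 0 < M) {A : Finset (Fin m)} (hA : A.card + M ≤ m)
    (T : Finset (Fin m × Fin m)) {z q : ℝ} (hz : 0 ≤ z) (hq : 0 < q)
    (hT : (T.card : ℝ) + A.card * (z * m) ≤ A.card * (q * M)) :
    ∑ π : Equiv.Perm (Fin m), z ^ (T ∪ graphOn A π).card
      ≤ m.factorial * q ^ A.card * z ^ T.card := by
  classical
  have hM' : (0 : ℝ) < M := by exact_mod_cast hM
  set w : Fin m → Fin m → ℝ := fun i j => if (i, j) ∈ T then 1 else z with hw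
  have hw0 : ∀ i j, 0 ≤ w i j := fun i j => by
    simp only [hw]; split_ifs <;> positivity
  have h1 : ∀ π : Equiv.Perm (Fin m),
      z ^ (T ∪ graphOn A π).card = z ^ T.card * ∏ i ∈ A, w i (π i) := by
    intro π
    rw [← union_sdiff_self_eq_union, card_union_of_disjoint disjoint_sdiff, pow_add]
    congr 1
    have : graphOn A π \ T = (A.filter fun i => (i, π i) ∉ T).image fun i => (i, π i) := by
      ext ⟨i, j⟩
      simp only [graphOn, Finset.mem_sdiff, mem_image, mem_filter, Prod.mk.injEq]
      constructor
      · rintro ⟨⟨i, hi, rfl, rfl⟩, h⟩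
        exact ⟨i, ⟨hi, h⟩, rfl, rfl⟩
      · rintro ⟨i, ⟨hi, h⟩, rfl, rfl⟩
        exact ⟨⟨i, hi, rfl, rfl⟩, h⟩
    rw [this, card_image_of_injective _ fun a b h => (Prod.mk.inj h).1]
    simp only [hw]
    rw [prod_ite, prod_const_one, one_mul, prod_const]
  have h2 : ∑ i ∈ A, (∑ j, w i j) / M ≤ A.card * q := by
    rw [← sum_div, div_le_iff₀ hM', mul_assoc]
    refine le_trans ?_ hT
    have hrow : ∀ i, ∑ j, w i j ≤ ((T.filter fun p => p.1 = i).card : ℝ) + z * m := by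
      intro i
      have : ∀ j, w i j ≤ (if (i, j) ∈ T then (1 : ℝ) else 0) + z := by
        intro j
        simp only [hw]; split_ifs <;> linarith
      refine (sum_le_sum fun j _ => this j).trans ?_
      rw [sum_add_distrib, sum_boole, sum_const, card_univ, Fintype.card_fin, nsmul_eq_mul,
        mul_comm z]
      gcongr
      refine card_le_card_of_injOn (fun j => (i, j)) ?_ fun a _ b _ h => (Prod.mk.inj h).2
      intro j hj
      simpa using hj
    refine (sum_le_sum fun i _ => hrow i).trans ?_
    rw [sum_add_distrib, sum_const, nsmul_eq_mul]
    gcongr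
    have : ∑ i ∈ A, (T.filter fun p => p.1 = i).card ≤ T.card :=
      calc _ = (T.filter fun p => p.1 ∈ A).card := by
            rw [card_eq_sum_card_fiberwise (f := Prod.fst) (t := A) (fun p hp => by simp_all)]
            refine sum_congr rfl fun i hi => ?_
            congr 1
            ext p
            simp only [mem_filter]
            constructor
            · rintro ⟨h, rfl⟩; exact ⟨⟨h, hi⟩, rfl⟩
            · rintro ⟨⟨h, -⟩, rfl⟩; exact ⟨h, rfl⟩
        _ ≤ T.card := card_filter_le _ _
    exact_mod_cast this
  simp only [h1, ← mul_sum]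
  have h3 := sum_perm_prod_le hM A hA w hw0
  have h4 := prod_le_mean_pow A (fun i => (∑ j, w i j) / M)
    (fun i _ => div_nonneg (sum_nonneg fun j _ => hw0 i j) hM'.le) hq h2
  calc z ^ T.card * ∑ π : Equiv.Perm (Fin m), ∏ i ∈ A, w i (π i)
      ≤ z ^ T.card * (m.factorial * q ^ A.card) := by
        gcongr
        exact h3.trans (by gcongr)
    _ = _ := by ring

open Finset in
/-- Exponential Markov inequality for the number of edges at `A`, starting from a set `T` that counts
as already present. The matchings are exposed one by one, and `sum_pow_card_union_le` applies as
long as at most `s` edges are present. -/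
theorem card_coveredBy_le {m M : ℕ} (hM : 0 < M) {A : Finset (Fin m)} (hA : A.card + M ≤ m)
    {z q : ℝ} (hz : 0 < z) (hz1 : z ≤ 1) (hq : 0 < q) {s : ℕ}
    (hs : (s : ℝ) + A.card * (z * m) ≤ A.card * (q * M)) (D : ℕ) (T : Finset (Fin m × Fin m)) :
    ((univ.filter fun ω : Fin D → Equiv.Perm (Fin m) => (T ∪ coveredBy A ω).card ≤ s).card : ℝ)
        * z ^ s ≤ (m.factorial * q ^ A.card) ^ D * z ^ T.card := by
  classical
  induction D generalizing T with
  | zero =>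
    rw [pow_zero, one_mul]
    by_cases h : T.card ≤ s
    · have hcard : ((univ.filter fun ω : Fin 0 → Equiv.Perm (Fin m) =>
          (T ∪ coveredBy A ω).card ≤ s).card : ℝ) ≤ 1 := by
        exact_mod_cast (card_le_univ _).trans (by simp)
      calc _ ≤ 1 * z ^ s := by gcongr
        _ ≤ z ^ T.card := by rw [one_mul]; exact pow_le_pow_of_le_one hz.le hz1 h
    · have : (univ.filter fun ω : Fin 0 → Equiv.Perm (Fin m) =>
          (T ∪ coveredBy A ω).card ≤ s) = ∅ := by
        ext ω
        simp only [mem_filter, mem_univ, true_and, notMem_empty, iff_false]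
        exact fun h' => h ((card_le_card subset_union_left).trans h')
      rw [this]
      simp only [card_empty, Nat.cast_zero, zero_mul]
      positivity
  | succ D ih =>
    by_cases h : T.card ≤ s
    · have hsplit : (univ.filter fun ω : Fin (D + 1) → Equiv.Perm (Fin m) =>
          (T ∪ coveredBy A ω).card ≤ s).card
          = ∑ π : Equiv.Perm (Fin m), (univ.filter fun ω : Fin D → Equiv.Perm (Fin m) =>
            ((T ∪ graphOn A π) ∪ coveredBy A ω).card ≤ s).card := by
        simp only [card_filter]
        rw [← (Fin.consEquiv fun _ => Equiv.Perm (Fin m)).sum_comp, Fintype.sum_prod_type]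
        refine sum_congr rfl fun π _ => sum_congr rfl fun ω _ => ?_
        have : T ∪ coveredBy A (Fin.cons π ω : Fin (D + 1) → Equiv.Perm (Fin m))
            = T ∪ graphOn A π ∪ coveredBy A ω := by
          rw [union_assoc]
          congr 1
          ext p
          simp [coveredBy, Fin.exists_fin_succ]
        rw [← this]
        rfl
  
      rw [hsplit]
      push_cast
      rw [sum_mul]
      calc _ ≤ ∑ π : Equiv.Perm (Fin m),
            (m.factorial * q ^ A.card) ^ D * z ^ (T ∪ graphOn A π).card :=
            sum_le_sum fun π _ => ih _
        _ ≤ (m.factorial * q ^ A.card) ^ D * (m.factorial * q ^ A.card * z ^ T.card) := by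
            rw [← mul_sum]
            gcongr
            refine sum_pow_card_union_le hM hA T hz.le hq (le_trans ?_ hs)
            gcongr
        _ = _ := by ring
    · have : (univ.filter fun ω : Fin (D + 1) → Equiv.Perm (Fin m) =>
          (T ∪ coveredBy A ω).card ≤ s) = ∅ := by
        ext ω
        simp only [mem_filter, mem_univ, true_and, notMem_empty, iff_false]
        exact fun h' => h ((card_le_card subset_union_left).trans h')
      rw [this]
      simp only [card_empty, Nat.cast_zero, zero_mul]
      positivity

/-- The edges of the union of the matchings `ω` from left vertices in `A` to right vertices outside
`B`. -/
def crossing {m D : ℕ} (ω : Fin D → Equiv.Perm (Fin m)) (A B : Finset (Fin m)) :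
    Finset (Fin m × Fin m) :=
  (coveredBy A ω).filter fun p => p.2 ∉ B

open Finset in
/-- The tail bound for a given pair `A`, `B`: apply `card_coveredBy_le` with all the pairs in `A × B`
present from the start, so that only the edges leaving `B` count as new. -/
theorem card_crossing_le {m M : ℕ} (hM : 0 < M) {A B : Finset (Fin m)} (hA : A.card + M ≤ m)
    {z q φ : ℝ} (hz : 0 < z) (hz1 : z ≤ 1) (hq : 0 < q)
    (hφ : 0 ≤ φ) (h : B.card + φ + z * m ≤ q * M) (D : ℕ) :
    ((univ.filter fun ω : Fin D → Equiv.Perm (Fin m) =>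
        ((crossing ω A B).card : ℝ) ≤ φ * A.card).card : ℝ)
      ≤ (m.factorial : ℝ) ^ D * (q ^ (D : ℝ) * z ^ (-φ)) ^ A.card := by
  classical
  set t := ⌊φ * A.card⌋₊ with ht
  have ht' : (t : ℝ) ≤ φ * A.card := Nat.floor_le (by positivity)
  have h1 := card_coveredBy_le hM hA hz hz1 hq (s := (A ×ˢ B).card + t) (by
    rw [card_product]; push_cast
    nlinarith [mul_le_mul_of_nonneg_left h (Nat.cast_nonneg (α := ℝ) A.card)]) D (A ×ˢ B)
  have h2 : (univ.filter fun ω : Fin D → Equiv.Perm (Fin m) =>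
        ((crossing ω A B).card : ℝ) ≤ φ * A.card)
      ⊆ univ.filter fun ω : Fin D → Equiv.Perm (Fin m) =>
        (A ×ˢ B ∪ coveredBy A ω).card ≤ (A ×ˢ B).card + t := by
    intro ω
    simp only [mem_filter, mem_univ, true_and]
    intro hω
    have hsub : A ×ˢ B ∪ coveredBy A ω ⊆ A ×ˢ B ∪ crossing ω A B := by
      intro p
      simp only [mem_union, crossing, mem_filter, mem_product]
      rintro (hp | hp)
      · exact Or.inl hp
      · by_cases hB : p.2 ∈ B
        · refine Or.inl ⟨?_, hB⟩
          simp only [coveredBy, graphOn, mem_biUnion, mem_image] at hp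
          obtain ⟨k, -, i, hi, rfl⟩ := hp
          exact hi
        · exact Or.inr ⟨hp, hB⟩
    exact (card_le_card hsub).trans ((card_union_le _ _).trans
      (Nat.add_le_add_left (Nat.le_floor hω) _))
  have h3 : ((univ.filter fun ω : Fin D → Equiv.Perm (Fin m) =>
        ((crossing ω A B).card : ℝ) ≤ φ * A.card).card : ℝ) * z ^ t
      ≤ (m.factorial * q ^ A.card) ^ D := by
    rw [pow_add, mul_comm (z ^ _), ← mul_assoc] at h1
    have h4 := le_of_mul_le_mul_right h1 (pow_pos hz _)
    refine le_trans ?_ h4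
    gcongr
  have h5 : z ^ (φ * A.card) ≤ z ^ t := by
    rw [← Real.rpow_natCast z t]
    exact Real.rpow_le_rpow_of_exponent_ge hz hz1 ht'
  have h6 : (0 : ℝ) < z ^ (φ * A.card) := Real.rpow_pos_of_pos hz _
  have h7 : (m.factorial : ℝ) ^ D * (q ^ (D : ℝ) * z ^ (-φ)) ^ A.card
      = (m.factorial * q ^ A.card) ^ D / z ^ (φ * A.card) := by
    rw [mul_pow, mul_pow, Real.rpow_neg hz.le, inv_pow, ← Real.rpow_natCast (z ^ φ),
      ← Real.rpow_mul hz.le, Real.rpow_natCast, ← pow_mul, ← pow_mul, mul_comm D]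
    field_simp
  rw [h7, le_div_iff₀ h6]
  exact (mul_le_mul_of_nonneg_left h5 (by positivity)).trans h3

/-! ### The union bound over cuts -/

open Finset in
/-- Bound `∑ B, u ^ |B| = (1 + u) ^ m` from below, at `u = a / m`. -/
theorem card_filter_card_le_le {m a : ℕ} (ha : 0 < a) (ham : a ≤ m) :
    ((univ.filter fun B : Finset (Fin m) => B.card ≤ a).card : ℝ)
      ≤ (Real.exp 1 * m / a) ^ a := by
  have ha' : (0 : ℝ) < a := by exact_mod_cast ha
  have hm' : (0 : ℝ) < m := by exact_mod_cast ha.trans_le ham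
  set u : ℝ := a / m with hu
  have hu0 : 0 < u := by positivity
  have hu1 : u ≤ 1 := by
    rw [hu, div_le_one hm']; exact_mod_cast ham
  have h1 := Fintype.sum_pow_mul_eq_add_pow (Fin m) u 1
  simp only [one_pow, mul_one, Fintype.card_fin] at h1
  have h2 : ((univ.filter fun B : Finset (Fin m) => B.card ≤ a).card : ℝ) * u ^ a
      ≤ (u + 1) ^ m := by
    rw [← h1, ← nsmul_eq_mul]
    calc _ ≤ ∑ B ∈ univ.filter (fun B : Finset (Fin m) => B.card ≤ a), u ^ B.card := by
          refine card_nsmul_le_sum _ _ _ fun B hB => ?_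
          exact pow_le_pow_of_le_one hu0.le hu1 (mem_filter.1 hB).2
      _ ≤ _ := sum_le_sum_of_subset_of_nonneg (subset_univ _) fun _ _ _ => by positivity
  have h3 : (u + 1) ^ m ≤ Real.exp 1 ^ a := by
    calc (u + 1) ^ m ≤ Real.exp u ^ m :=
          pow_le_pow_left₀ (by positivity) (Real.add_one_le_exp u) _
      _ = Real.exp 1 ^ a := by
          rw [← Real.exp_nat_mul, ← Real.exp_nat_mul, hu]
          congr 1; field_simp
  have h4 : (Real.exp 1 * m / a) ^ a = Real.exp 1 ^ a / u ^ a := by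
    rw [← div_pow, hu]; congr 1; field_simp
  rw [h4, le_div_iff₀ (by positivity)]
  exact h2.trans h3

theorem div_pow_self_le {m a : ℕ} (ha : 0 < a) (hm : 2 * a ≤ m) :
    ((a : ℝ) / m) ^ a ≤ 1 / m := by
  obtain ⟨n, rfl⟩ : ∃ n, a = n + 1 := ⟨a - 1, by omega⟩
  have hm0 : (0 : ℝ) < m := by exact_mod_cast (by omega : 0 < m)
  have hu0 : 0 ≤ (((n + 1 : ℕ) : ℝ) / m) := by positivity
  have hu : (((n + 1 : ℕ) : ℝ) / m) ≤ 1 / 2 := by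
    rw [div_le_iff₀ hm0]
    have : ((2 * (n + 1) : ℕ) : ℝ) ≤ m := by exact_mod_cast hm
    push_cast at this ⊢
    linarith
  have h2 : ((n + 1 : ℕ) : ℝ) ≤ 2 ^ n := by exact_mod_cast Nat.lt_two_pow_self
  rw [pow_succ, mul_div_assoc', div_le_div_iff_of_pos_right hm0]
  calc (((n + 1 : ℕ) : ℝ) / m) ^ n * (n + 1 : ℕ) ≤ (1 / 2) ^ n * 2 ^ n := by gcongr
    _ = 1 := by rw [← mul_pow]; norm_num

/-- The estimate behind the union bound over the small sets. With `φ = ρ d / 200` and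
`y = (a + φ) / m`, the probability for one pair of sets is at most `(y ^ (D / 2) * y ^ (-φ)) ^ a`, and
there are at most `((e m / a) ^ 2) ^ a` pairs. The point is that `y ^ (3 / ρ) ≤ a / (e m)`: if
`φ ≤ a`, then `y` is comparable with `a / m`; otherwise `y ≤ m ^ (-ρ)`, by `d ≤ m ^ (1 - ρ)`. As
`d ≥ 1200 / ρ`, the probability then beats the number of pairs. -/
theorem small_set_estimate {ρ d m a D : ℝ} (hρ0 : 0 < ρ) (hρ1 : ρ < 1) (hd : 4 + 1200 / ρ ≤ d)
    (hdm : d ≤ m ^ (1 - ρ)) (hm : 1204 ≤ m) (ha : 1 ≤ a) (ham : 8 * a ≤ m) (hD : 0.99 * d ≤ D) :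
    (Real.exp 1 * m / a) ^ 2 *
        (((a + ρ * d / 200) / m) ^ (D / 2) *
          ((a + ρ * d / 200) / m) ^ (-(ρ * d / 200))) ≤ (a / m) ^ 2 := by
  have hm0 : 0 < m := by linarith
  have hq0 : 1200 ≤ 1200 / ρ := by
    rw [le_div_iff₀ hρ0]; nlinarith
  have hd0 : 1204 ≤ d := by linarith
  have hφ0 : 0 < ρ * d / 200 := by positivity
  have hdm' : d ≤ m := hdm.trans (by
    calc m ^ (1 - ρ) ≤ m ^ (1 : ℝ) := Real.rpow_le_rpow_of_exponent_le (by linarith) (by linarith)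
      _ = m := Real.rpow_one m)
  set φ := ρ * d / 200 with hφ
  have hφd : φ ≤ d / 200 := by rw [hφ]; nlinarith
  set y := (a + φ) / m with hy
  have hy0 : 0 < y := by positivity
  have hy1 : y ≤ 1 / 7 := by
    rw [hy, div_le_iff₀ hm0]; linarith
  set R := Real.exp 1 * m / a with hR
  have he1 : 2.7 < Real.exp 1 := lt_trans (by norm_num) Real.exp_one_gt_d9
  have he2 : Real.exp 1 < 3 := lt_trans Real.exp_one_lt_d9 (by norm_num)
  have hR1 : m / a ≤ R := by
    rw [hR]; gcongr; nlinarith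
  have hR8 : 1 ≤ m / a := by
    rw [le_div_iff₀ (by linarith)]; linarith
  have hR0 : 0 < R := by positivity
  have key : y ^ (3 / ρ) ≤ R⁻¹ := by
    have hRinv : a / (3 * m) ≤ R⁻¹ := by
      rw [hR, inv_div]; gcongr
    refine le_trans ?_ hRinv
    rcases le_or_gt φ a with h | h
    · have h3 : (3 : ℝ) ≤ 3 / ρ := by rw [le_div_iff₀ hρ0]; linarith
      calc y ^ (3 / ρ) ≤ y ^ (3 : ℝ) :=
            Real.rpow_le_rpow_of_exponent_ge hy0 (by linarith) h3
        _ = y ^ 2 * y := by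
            rw [show (3 : ℝ) = ((3 : ℕ) : ℝ) by norm_num, Real.rpow_natCast]; ring
        _ ≤ (1 / 7) ^ 2 * (2 * a / m) := by
            gcongr
            rw [hy]; gcongr; linarith
        _ ≤ a / (3 * m) := by
            rw [mul_div_assoc', div_le_div_iff₀ hm0 (by positivity)]
            nlinarith [mul_pos (by linarith : 0 < a) hm0]
    · have h1 : y ≤ m ^ (-ρ) := by
        have : m ^ (1 - ρ) = m * m ^ (-ρ) := by
          rw [sub_eq_add_neg, Real.rpow_add hm0, Real.rpow_one]
        rw [hy, div_le_iff₀ hm0]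
        linarith
      calc y ^ (3 / ρ) ≤ (m ^ (-ρ)) ^ (3 / ρ) := Real.rpow_le_rpow hy0.le h1 (by positivity)
        _ = m ^ (-3 : ℝ) := by
            rw [← Real.rpow_mul hm0.le]; congr 1; field_simp
        _ = 1 / m ^ 3 := by
            rw [Real.rpow_neg hm0.le, show (3 : ℝ) = ((3 : ℕ) : ℝ) by norm_num,
              Real.rpow_natCast]; simp
        _ ≤ 1 / (3 * m) := by
            gcongr
            nlinarith [mul_pos hm0 hm0]
        _ ≤ a / (3 * m) := by gcongr
  have h1 : y ^ (D / 2) * y ^ (-φ) ≤ (R⁻¹) ^ 100 := by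
    rw [← Real.rpow_add hy0]
    calc y ^ (D / 2 + -φ) ≤ y ^ (3 / ρ * (100 : ℕ)) := by
          refine Real.rpow_le_rpow_of_exponent_ge hy0 (by linarith) ?_
          have : 3 / ρ * (100 : ℕ) = 1200 / ρ / 4 := by push_cast; ring
          rw [this]; linarith
      _ = (y ^ (3 / ρ)) ^ 100 := by rw [Real.rpow_mul hy0.le, Real.rpow_natCast]
      _ ≤ _ := by gcongr
  calc R ^ 2 * (y ^ (D / 2) * y ^ (-φ)) ≤ R ^ 2 * (R⁻¹) ^ 100 := by gcongr
    _ = (R⁻¹) ^ 98 := by field_simp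
    _ ≤ (R⁻¹) ^ 2 := by
        refine pow_le_pow_of_le_one (by positivity) ?_ (by norm_num)
        exact inv_le_one_of_one_le₀ (hR8.trans hR1)
    _ ≤ ((m / a)⁻¹) ^ 2 := by gcongr
    _ = _ := by rw [inv_div]

open Finset in
/-- The union bound. -/
theorem card_exists_le_card_mul {ι Ω : Type*} [Fintype Ω] (I : Finset ι) (p : ι → Ω → Prop)
    (c : ℝ) [∀ i, DecidablePred (p i)] [DecidablePred fun x => ∃ i ∈ I, p i x]
    (h : ∀ i ∈ I, ((univ.filter (p i)).card : ℝ) ≤ c) :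
    ((univ.filter fun x => ∃ i ∈ I, p i x).card : ℝ) ≤ I.card * c := by
  classical
  have hsub : (univ.filter fun x => ∃ i ∈ I, p i x) ⊆ I.biUnion fun i => univ.filter (p i) := by
    intro x
    simp
  calc _ ≤ ((∑ i ∈ I, (univ.filter (p i)).card : ℕ) : ℝ) := by
        exact_mod_cast (card_le_card hsub).trans card_biUnion_le
    _ ≤ _ := by
        push_cast
        rw [← nsmul_eq_mul]
        exact sum_le_card_nsmul _ _ _ h

open Finset Classical in
/-- Sparse cuts with `|A| ≤ m / 8` and `|B| ≤ |A|` are unlikely. For each `|A| = a`, the tail bound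
`card_crossing_le` is used with `z = y` and `q = √y`, where `y = (a + ρ d / 200) / m`. -/
theorem card_small_crossing_le {ρ : ℝ} {m d D : ℕ} (hρ0 : 0 < ρ) (hρ1 : ρ < 1)
    (hd : 4 + 1200 / ρ ≤ (d : ℝ)) (hdm : (d : ℝ) ≤ (m : ℝ) ^ (1 - ρ)) (hm : 1204 ≤ m)
    (hD : 0.99 * (d : ℝ) ≤ D) :
    ((univ.filter fun ω : Fin D → Equiv.Perm (Fin m) => ∃ a ∈ Icc 1 (m / 8),
      ∃ p ∈ (univ.filter fun A : Finset (Fin m) => A.card ≤ a) ×ˢ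
        (univ.filter fun B : Finset (Fin m) => B.card ≤ a),
        p.1.card = a ∧ ((crossing ω p.1 p.2).card : ℝ) ≤ ρ * d / 200 * p.1.card).card : ℝ)
      ≤ (m.factorial : ℝ) ^ D / m := by
  have hm' : (1204 : ℝ) ≤ m := by exact_mod_cast hm
  have hm0 : (0 : ℝ) < m := by linarith
  have hd0 : (0 : ℝ) ≤ d := Nat.cast_nonneg d
  have hdm' : (d : ℝ) ≤ m := hdm.trans (by
    calc (m : ℝ) ^ (1 - ρ) ≤ (m : ℝ) ^ (1 : ℝ) :=
          Real.rpow_le_rpow_of_exponent_le (by linarith) (by linarith)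
      _ = m := Real.rpow_one _)
  have hφd : ρ * d / 200 ≤ m / 200 := by nlinarith
  have hφ0 : 0 ≤ ρ * d / 200 := by positivity
  calc _ ≤ ((Icc 1 (m / 8)).card : ℝ) * ((m.factorial : ℝ) ^ D / m ^ 2) := by
        refine card_exists_le_card_mul _ _ _ fun a ha => ?_
        rw [mem_Icc] at ha
        have ham : 8 * a ≤ m := by omega
        have ha' : (1 : ℝ) ≤ a := by exact_mod_cast ha.1
        have ham' : 8 * (a : ℝ) ≤ m := by exact_mod_cast ham
        set y : ℝ := (a + ρ * d / 200) / m with hy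
        have hy0 : 0 < y := by positivity
        have hy1 : y ≤ 1 / 7 := by
          rw [hy, div_le_iff₀ hm0]; linarith
        have hym : y * m = a + ρ * d / 200 := by rw [hy]; field_simp
        have hs : y ≤ √y * (49 / 128) := by
          have h1 : √y ≤ 49 / 128 := by
            rw [Real.sqrt_le_left (by norm_num)]
            linarith
          nlinarith [Real.mul_self_sqrt hy0.le, Real.sqrt_nonneg y]
        have hsD : (√y) ^ (D : ℝ) = y ^ ((D : ℝ) / 2) := by
          rw [Real.sqrt_eq_rpow, ← Real.rpow_mul hy0.le]
          congr 1; ring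
        have hcount := card_filter_card_le_le ha.1 (by omega : a ≤ m)
        refine (card_exists_le_card_mul _ _ ((m.factorial : ℝ) ^ D *
          (y ^ ((D : ℝ) / 2) * y ^ (-(ρ * d / 200))) ^ a) fun p hp => ?_).trans ?_
        · simp only [mem_product, mem_filter, mem_univ, true_and] at hp
          by_cases hpa : p.1.card = a
          · have h := card_crossing_le (M := m - a) (A := p.1) (B := p.2) (z := y) (q := √y)
              (φ := ρ * d / 200) (by omega) (by omega) hy0 (by linarith) (Real.sqrt_pos.2 hy0)
              hφ0 (by
                have hB : (p.2.card : ℝ) ≤ a := by exact_mod_cast hp.2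
                rw [Nat.cast_sub (by omega)]
                nlinarith [Real.sqrt_nonneg y]) D
            rw [hsD, hpa] at h
            simpa [hpa] using h
          · simp only [hpa, false_and, filter_false, card_empty, Nat.cast_zero]
            positivity
        · rw [card_product]
          push_cast
          have hest := small_set_estimate hρ0 hρ1 hd hdm hm' ha' ham' hD
          have hpow := div_pow_self_le (m := m) ha.1 (by omega)
          calc _ ≤ ((Real.exp 1 * m / a) ^ a * (Real.exp 1 * m / a) ^ a) *
                ((m.factorial : ℝ) ^ D * (y ^ ((D : ℝ) / 2) * y ^ (-(ρ * d / 200))) ^ a) := by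
                gcongr
            _ = (m.factorial : ℝ) ^ D * ((Real.exp 1 * m / a) ^ 2 *
                  (y ^ ((D : ℝ) / 2) * y ^ (-(ρ * d / 200)))) ^ a := by
                rw [mul_pow (_ ^ 2)]; ring
            _ ≤ (m.factorial : ℝ) ^ D * ((a / m) ^ 2) ^ a := by gcongr
            _ = (m.factorial : ℝ) ^ D * ((a / m) ^ a) ^ 2 := by rw [← pow_mul, ← pow_mul, mul_comm 2]
            _ ≤ (m.factorial : ℝ) ^ D * (1 / m) ^ 2 := by gcongr
            _ = _ := by rw [one_div, inv_pow, div_eq_mul_inv]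
    _ ≤ m * ((m.factorial : ℝ) ^ D / m ^ 2) := by
        gcongr
        rw [Nat.card_Icc]
        omega
    _ = _ := by field_simp

open Finset Classical in
/-- Sparse cuts with `|A| = m / 8` and `|B| ≤ m / 2` are unlikely. Here the tail bound with
`z = exp (-3)` and `q = exp (-0.3)` is exponentially small in `d * m`, while there are only `4 ^ m`
pairs of sets. -/
theorem card_large_crossing_le {ρ : ℝ} {m d D : ℕ} (hρ0 : 0 < ρ) (hρ1 : ρ < 1)
    (hd : 1204 ≤ d) (hdm : d ≤ m) (hD : 0.99 * (d : ℝ) ≤ D) :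
    ((univ.filter fun ω : Fin D → Equiv.Perm (Fin m) =>
      ∃ p ∈ (univ : Finset (Finset (Fin m) × Finset (Fin m))),
        (p.1.card = m / 8 ∧ 2 * p.2.card ≤ m) ∧
          ((crossing ω p.1 p.2).card : ℝ) ≤ 9 * (ρ * d / 200) * p.1.card).card : ℝ)
      ≤ (m.factorial : ℝ) ^ D / m := by
  have hd' : (1204 : ℝ) ≤ d := by exact_mod_cast hd
  have hdm' : (d : ℝ) ≤ m := by exact_mod_cast hdm
  have hm0 : (0 : ℝ) < m := by linarith
  have hφd : ρ * d / 200 ≤ d / 200 := by nlinarith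
  have hφ0 : 0 ≤ ρ * d / 200 := by positivity
  have he3 : Real.exp (-3) ≤ 1 / 16 := by
    rw [Real.exp_neg, one_div]
    gcongr
    have : (2.7 : ℝ) ^ 3 ≤ Real.exp 1 ^ 3 := by
      gcongr
      exact (lt_trans (by norm_num) Real.exp_one_gt_d9).le
    rw [← Real.exp_nat_mul] at this
    norm_num at this ⊢
    linarith
  have hq : 0.7 ≤ Real.exp (-0.3) := by
    have := Real.add_one_le_exp (-0.3 : ℝ)
    linarith
  have ha9 : m ≤ 9 * (m / 8) := by omega
  have ha9' : (m : ℝ) ≤ 9 * (m / 8 : ℕ) := by exact_mod_cast ha9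
  have ha8' : 8 * ((m / 8 : ℕ) : ℝ) ≤ m := by exact_mod_cast (by omega : 8 * (m / 8) ≤ m)
  refine (card_exists_le_card_mul _ _ ((m.factorial : ℝ) ^ D * Real.exp (-(20 * m)))
    fun p _ => ?_).trans ?_
  · by_cases hp : p.1.card = m / 8 ∧ 2 * p.2.card ≤ m
    · have h := card_crossing_le (M := m - m / 8) (A := p.1) (B := p.2) (z := Real.exp (-3))
        (q := Real.exp (-0.3)) (φ := 9 * (ρ * d / 200)) (by omega) (by omega) (Real.exp_pos _)
        (by linarith) (Real.exp_pos _) (by positivity) (by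
          have hB : 2 * (p.2.card : ℝ) ≤ m := by exact_mod_cast hp.2
          rw [Nat.cast_sub (by omega)]
          nlinarith) D
      simp only [hp, and_self, true_and] at h ⊢
      refine h.trans ?_
      gcongr
      rw [← Real.exp_mul, ← Real.exp_mul, ← Real.exp_add, ← Real.exp_nat_mul, Real.exp_le_exp]
      have h1 : -0.3 * (D : ℝ) + -3 * -(9 * (ρ * d / 200)) ≤ -180 := by linarith
      nlinarith
    · simp only [hp, false_and, filter_false, card_empty, Nat.cast_zero]
      positivity
  · have h4 : (univ : Finset (Finset (Fin m) × Finset (Fin m))).card = 4 ^ m := by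
      rw [card_univ, Fintype.card_prod, Fintype.card_finset, Fintype.card_fin, ← mul_pow]
      norm_num
    rw [h4]
    have h5 : (4 : ℝ) ^ m ≤ Real.exp (3 * m) := by
      rw [mul_comm, Real.exp_nat_mul]
      gcongr
      linarith [Real.add_one_le_exp (3 : ℝ)]
    have h6 : (m : ℝ) ≤ Real.exp m := by linarith [Real.add_one_le_exp (m : ℝ)]
    rw [le_div_iff₀ hm0]
    push_cast
    calc _ ≤ Real.exp (3 * m) * ((m.factorial : ℝ) ^ D * Real.exp (-(20 * m))) * Real.exp m := by
          gcongr
      _ = (m.factorial : ℝ) ^ D * Real.exp (-(16 * m)) := by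
          rw [show -(16 * (m : ℝ)) = 3 * m + -(20 * m) + m by ring, Real.exp_add, Real.exp_add]
          ring
      _ ≤ (m.factorial : ℝ) ^ D * 1 := by
          gcongr
          rw [Real.exp_le_one_iff]
          linarith
      _ = _ := mul_one _

/-- The union of the matchings `ω` has a sparse cut on the left side: sets `A` of left and `B` of right
vertices with `|B| ≤ |A|` and `|A| + |B| ≤ m`, and at most `φ |A|` edges from `A` to the outside of
`B`. Sparse cuts on the right side are those of `ω⁻¹`. -/
def HasSparseCut {m D : ℕ} (φ : ℝ) (ω : Fin D → Equiv.Perm (Fin m)) : Prop :=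
  ∃ A B : Finset (Fin m), A.Nonempty ∧ B.card ≤ A.card ∧ A.card + B.card ≤ m ∧
    ((crossing ω A B).card : ℝ) ≤ φ * A.card

theorem crossing_mono {m D : ℕ} (ω : Fin D → Equiv.Perm (Fin m)) {A A' : Finset (Fin m)}
    (h : A' ⊆ A) (B : Finset (Fin m)) : crossing ω A' B ⊆ crossing ω A B :=
  Finset.filter_subset_filter _ (Finset.biUnion_mono fun _ _ => Finset.image_subset_image h)

open Finset Classical in
theorem card_hasSparseCut_le {ρ : ℝ} {m d D : ℕ} (hρ0 : 0 < ρ) (hρ1 : ρ < 1)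
    (hd : 4 + 1200 / ρ ≤ (d : ℝ)) (hdm : (d : ℝ) ≤ (m : ℝ) ^ (1 - ρ)) (hd0 : 1204 ≤ d)
    (hdm' : d ≤ m) (hD : 0.99 * (d : ℝ) ≤ D) :
    ((univ.filter fun ω : Fin D → Equiv.Perm (Fin m) => HasSparseCut (ρ * d / 200) ω).card : ℝ)
      ≤ 2 / m * (m.factorial : ℝ) ^ D := by
  have h1 := card_small_crossing_le hρ0 hρ1 hd hdm (hd0.trans hdm') hD
  have h2 := card_large_crossing_le hρ0 hρ1 hd0 hdm' hD
  have h3 : 2 / (m : ℝ) * (m.factorial : ℝ) ^ D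
      = (m.factorial : ℝ) ^ D / m + (m.factorial : ℝ) ^ D / m := by ring
  rw [h3]
  refine le_trans ?_ (add_le_add h1 h2)
  rw [← Nat.cast_add, Nat.cast_le]
  refine le_trans (card_le_card ?_) (card_union_le _ _)
  intro ω
  simp only [mem_filter, mem_univ, true_and, mem_union]
  rintro ⟨A, B, hA, hBA, hAB, hω⟩
  by_cases h8 : 8 * A.card ≤ m
  · left
    refine ⟨A.card, mem_Icc.2 ⟨hA.card_pos, by omega⟩, (A, B), ?_, rfl, hω⟩
    simpa using hBA
  · right
    -- Shrinking `A` to `m / 8` elements loses a factor of at most `9` in its size.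
    obtain ⟨A', hA', hcard⟩ := exists_subset_card_eq (s := A) (n := m / 8) (by omega)
    refine ⟨(A', B), ⟨hcard, by dsimp only; omega⟩, ?_⟩
    have h4 : ((crossing ω A' B).card : ℝ) ≤ (crossing ω A B).card := by
      exact_mod_cast card_le_card (crossing_mono ω hA' B)
    have h5 : (A.card : ℝ) ≤ 9 * A'.card := by
      rw [hcard]
      exact_mod_cast (by omega : A.card ≤ 9 * (m / 8))
    have h6 : 0 ≤ ρ * d / 200 := by positivity
    dsimp only
    nlinarith [mul_le_mul_of_nonneg_left h5 h6]

open Finset Classical in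
theorem card_hasSparseCut_or_inv_le {ρ : ℝ} {m d D : ℕ} (hρ0 : 0 < ρ) (hρ1 : ρ < 1)
    (hd : 4 + 1200 / ρ ≤ (d : ℝ)) (hdm : (d : ℝ) ≤ (m : ℝ) ^ (1 - ρ)) (hd0 : 1204 ≤ d)
    (hdm' : d ≤ m) (hD : 0.99 * (d : ℝ) ≤ D) :
    ((univ.filter fun ω : Fin D → Equiv.Perm (Fin m) =>
        HasSparseCut (ρ * d / 200) ω ∨ HasSparseCut (ρ * d / 200) ω⁻¹).card : ℝ)
      ≤ 4 / m * (m.factorial : ℝ) ^ D := by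
  have h1 := card_hasSparseCut_le hρ0 hρ1 hd hdm hd0 hdm' hD
  have h2 : (univ.filter fun ω : Fin D → Equiv.Perm (Fin m) =>
      HasSparseCut (ρ * d / 200) ω⁻¹).card
      = (univ.filter fun ω : Fin D → Equiv.Perm (Fin m) => HasSparseCut (ρ * d / 200) ω).card := by
    refine card_equiv (Equiv.inv _) fun ω => ?_
    simp
  rw [filter_or]
  have h3 := card_union_le
    (univ.filter fun ω : Fin D → Equiv.Perm (Fin m) => HasSparseCut (ρ * d / 200) ω)
    (univ.filter fun ω : Fin D → Equiv.Perm (Fin m) => HasSparseCut (ρ * d / 200) ω⁻¹)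
  rw [h2] at h3
  have h4 : 4 / (m : ℝ) * (m.factorial : ℝ) ^ D
      = 2 / m * (m.factorial : ℝ) ^ D + 2 / m * (m.factorial : ℝ) ^ D := by ring
  rw [h4]
  refine le_trans ?_ (add_le_add h1 h1)
  exact_mod_cast h3

/-! ### Transfer to the gadget -/

open Finset in
theorem mem_crossing {m D : ℕ} {ω : Fin D → Equiv.Perm (Fin m)} {A B : Finset (Fin m)}
    {p : Fin m × Fin m} : p ∈ crossing ω A B ↔ p.1 ∈ A ∧ p.2 ∉ B ∧ ∃ k, ω k p.1 = p.2 := by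
  obtain ⟨i, j⟩ := p
  simp only [crossing, coveredBy, graphOn, mem_filter, mem_biUnion, mem_univ, true_and, mem_image,
    Prod.mk.injEq]
  constructor
  · rintro ⟨⟨k, i, hi, rfl, rfl⟩, hj⟩
    exact ⟨hi, hj, k, rfl⟩
  · rintro ⟨hi, hj, k, rfl⟩
    exact ⟨⟨k, i, hi, rfl, rfl⟩, hj⟩

/-- Only the edges leaving the larger of the two sides of `S`, which has at least `|S| / 2` vertices,
are counted. -/
theorem mul_card_le_ncard_edgeBoundary {m D : ℕ} {ω : Fin D → Equiv.Perm (Fin m)} {φ : ℝ}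
    (hφ : 0 ≤ φ) (h1 : ¬ HasSparseCut φ ω) (h2 : ¬ HasSparseCut φ ω⁻¹)
    {G : SimpleGraph (GadgetVertex m)} (hG : ∀ k i, G.Adj (Sum.inl i) (Sum.inr (ω k i)))
    {S : Finset (GadgetVertex m)} (hS : S.Nonempty) (hSm : S.card ≤ m) :
    φ / 2 * S.card ≤ (edgeBoundary G S).ncard := by
  have hcard : S.toLeft.card + S.toRight.card = S.card := S.card_toLeft_add_card_toRight
  have hpos := hS.card_pos
  have hcardR : (S.toLeft.card : ℝ) + S.toRight.card = S.card := by exact_mod_cast hcard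
  rcases le_total S.toRight.card S.toLeft.card with h | h
  · have h3 : φ * S.toLeft.card < (crossing ω S.toLeft S.toRight).card := by
      by_contra! h3
      exact h1 ⟨_, _, Finset.card_pos.1 (by omega), h, by omega, h3⟩
    have h4 : (crossing ω S.toLeft S.toRight).card ≤ (edgeBoundary G S).ncard := by
      rw [← Set.ncard_coe_finset]
      refine Set.ncard_le_ncard_of_injOn (fun p => (Sum.inl p.1, Sum.inr p.2)) ?_ ?_
        (Set.toFinite _)
      · rintro ⟨i, j⟩ hp
        obtain ⟨hi, hj, k, hk⟩ := mem_crossing.1 (Finset.mem_coe.1 hp)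
        obtain rfl : ω k i = j := hk
        exact ⟨Finset.mem_toLeft.1 hi, fun h => hj (Finset.mem_toRight.2 h), hG k i⟩
      · rintro ⟨i, j⟩ - ⟨i', j'⟩ - heq
        simpa using heq
    have h4' : ((crossing ω S.toLeft S.toRight).card : ℝ) ≤ (edgeBoundary G S).ncard := by
      exact_mod_cast h4
    have h' : (S.toRight.card : ℝ) ≤ S.toLeft.card := by exact_mod_cast h
    nlinarith
  · have h3 : φ * S.toRight.card < (crossing ω⁻¹ S.toRight S.toLeft).card := by
      by_contra! h3
      exact h2 ⟨_, _, Finset.card_pos.1 (by omega), h, by omega, h3⟩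
    have h4 : (crossing ω⁻¹ S.toRight S.toLeft).card ≤ (edgeBoundary G S).ncard := by
      rw [← Set.ncard_coe_finset]
      refine Set.ncard_le_ncard_of_injOn (fun p => (Sum.inr p.1, Sum.inl p.2)) ?_ ?_
        (Set.toFinite _)
      · rintro ⟨j, i⟩ hp
        obtain ⟨hj, hi, k, hk⟩ := mem_crossing.1 (Finset.mem_coe.1 hp)
        have hk' : ω k i = j := by
          obtain rfl : (ω⁻¹ k) j = i := hk
          simp
        refine ⟨Finset.mem_toRight.1 hj, fun h => hi (Finset.mem_toLeft.2 h), ?_⟩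
        have := hG k i
        rw [hk'] at this
        exact this.symm
      · rintro ⟨i, j⟩ - ⟨i', j'⟩ - heq
        simpa using heq
    have h4' : ((crossing ω⁻¹ S.toRight S.toLeft).card : ℝ) ≤ (edgeBoundary G S).ncard := by
      exact_mod_cast h4
    have h' : (S.toLeft.card : ℝ) ≤ S.toRight.card := by exact_mod_cast h
    nlinarith

theorem plusPhase_ne_of_adj {m p dIn dOut : ℕ} (ω : GadgetSample m p dIn dOut)
    (u v : GadgetVertex m) (h : ω.graph.Adj u v) : plusPhase m u ≠ plusPhase m v := by
  rw [GadgetSample.graph, SimpleGraph.fromEdgeSet_adj] at h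
  have key : ∀ i j : Fin m, s(Sum.inl i, Sum.inr j) = s(u, v) → plusPhase m u ≠ plusPhase m v := by
    intro i j hij
    rw [Sym2.eq_iff] at hij
    rcases hij with ⟨rfl, rfl⟩ | ⟨rfl, rfl⟩ <;> simp [plusPhase]
  rcases h.1 with h | h
  · obtain ⟨k, i, hi⟩ := Set.mem_iUnion.1 h
    exact key _ _ hi
  · obtain ⟨k, i, hi⟩ := Set.mem_iUnion.1 h
    exact key _ _ hi

theorem graph_adj_inner {m p dIn dOut : ℕ} (ω : GadgetSample m p dIn dOut) (k : Fin dIn)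
    (i : Fin m) : ω.graph.Adj (Sum.inl i) (Sum.inr (ω.2.1 k i)) := by
  rw [GadgetSample.graph, SimpleGraph.fromEdgeSet_adj]
  exact ⟨Or.inl (Set.mem_iUnion.2 ⟨k, i, rfl⟩), Sum.inl_ne_inr⟩

theorem portSet_eq_univ {m : ℕ} (P : PortSet m m) : P.1 = Finset.univ := by
  obtain ⟨P, hL, hR⟩ := P
  have hL' : P.toLeft = Finset.univ := by
    rw [← Finset.card_eq_iff_eq_univ, hL, Fintype.card_fin]
  have hR' : P.toRight = Finset.univ := by
    rw [← Finset.card_eq_iff_eq_univ, hR, Fintype.card_fin]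
  ext x
  rcases x with i | j
  · simpa using Finset.ext_iff.1 hL' i
  · simpa using Finset.ext_iff.1 hR' j

/-- When all vertices are ports, the inner matchings determine the sample: the outer matchings are
between empty sets. -/
theorem innerMatchings_bijective (m dIn dOut : ℕ) :
    Function.Bijective (fun ω : GadgetSample m m dIn dOut => ω.2.1) := by
  constructor
  · rintro ⟨P, f, g⟩ ⟨P', f', g'⟩ h
    have hP : P = P' := Subtype.ext ((portSet_eq_univ P).trans (portSet_eq_univ P').symm)
    subst hP
    have hf : f = f' := h
    subst hf
    have hg : g = g' := by
      ext k i
      exact absurd ((Finset.ext_iff.1 (portSet_eq_univ P) _).2 (Finset.mem_univ _)) i.2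
    rw [hg]
  · intro f
    have hc : (Finset.univ : Finset (GadgetVertex m)).toLeft.card = m ∧
        (Finset.univ : Finset (GadgetVertex m)).toRight.card = m := by
      simp
    exact ⟨⟨⟨Finset.univ, hc⟩, f, fun _ =>
      { toFun := fun i => absurd (Finset.mem_univ _) i.2
        invFun := fun i => absurd (Finset.mem_univ _) i.2
        left_inv := fun i => absurd (Finset.mem_univ _) i.2
        right_inv := fun i => absurd (Finset.mem_univ _) i.2 }⟩, rfl⟩

open Classical in
/-- Bounds for the number of bad tuples of inner matchings carry over to the gadget measure. -/
theorem gadgetMeasure_real_ge {m dIn dOut : ℕ} {s : Set (GadgetSample m m dIn dOut)}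
    {bad : (Fin dIn → Equiv.Perm (Fin m)) → Prop} [DecidablePred bad]
    (hs : ∀ ω, ¬ bad ω.2.1 → ω ∈ s) {ε : ℝ}
    (hbad : ((Finset.univ.filter bad).card : ℝ) ≤ ε * (m.factorial : ℝ) ^ dIn) :
    1 - ε ≤ (gadgetMeasure m m dIn dOut).real s := by
  have hbij := innerMatchings_bijective m dIn dOut
  have hcard : Fintype.card (GadgetSample m m dIn dOut) = m.factorial ^ dIn := by
    rw [Fintype.card_of_bijective hbij]
    simp [Fintype.card_perm]
  have hpos : (0 : ℝ) < (m.factorial : ℝ) ^ dIn := by positivity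
  have hreal : (gadgetMeasure m m dIn dOut).real s
      = ((Finset.univ.filter (· ∈ s)).card : ℝ) / (m.factorial : ℝ) ^ dIn := by
    have : Finite (GadgetSample m m dIn dOut) := Finite.of_fintype _
    rw [Measure.real, gadgetMeasure, ProbabilityTheory.uniformOn_univ, ENNReal.toReal_div]
    have : s = ((Finset.univ.filter (· ∈ s) : Finset (GadgetSample m m dIn dOut)) : Set _) := by
      ext; simp
    conv_lhs => rw [this]
    rw [Measure.count_apply_finset, hcard]
    simp
  have hcompl := Finset.card_filter_add_card_filter_not
    (s := (Finset.univ : Finset (GadgetSample m m dIn dOut))) (· ∈ s)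
  rw [Finset.card_univ, hcard] at hcompl
  have hle : (Finset.univ.filter fun ω : GadgetSample m m dIn dOut => ω ∉ s).card
      ≤ (Finset.univ.filter bad).card := by
    refine Finset.card_le_card_of_injOn (fun ω => ω.2.1) ?_ hbij.1.injOn
    intro ω hω
    simp only [Finset.coe_filter, Finset.mem_univ, true_and, Set.mem_ofPred_eq] at hω ⊢
    by_contra h
    exact hω (hs ω h)
  have hcompl' : ((Finset.univ.filter fun ω : GadgetSample m m dIn dOut => ω ∈ s).card : ℝ)
      + (Finset.univ.filter fun ω : GadgetSample m m dIn dOut => ω ∉ s).card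
      = (m.factorial : ℝ) ^ dIn := by exact_mod_cast hcompl
  have hle' : ((Finset.univ.filter fun ω : GadgetSample m m dIn dOut => ω ∉ s).card : ℝ)
      ≤ (Finset.univ.filter bad).card := by exact_mod_cast hle
  rw [hreal, le_div_iff₀ hpos]
  linarith

end IsingGadget

theorem theorem4p2 (ρ : ℝ) (hρ0 : 0 < ρ) (hρ1 : ρ < 1) :
    ∃ θ δ : ℝ, 0 < θ ∧ θ < 1 ∧ 0 < δ ∧
      ∃ ε : ℕ → ℝ, Tendsto ε atTop (𝓝 0) ∧
        ∀ (m d : ℕ), 4 + 1200 / ρ ≤ (d : ℝ) → (d : ℝ) ≤ (m : ℝ) ^ (1 - ρ) →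
          ∀ β : ℝ, β < 0 →
            1 - ε m ≤ (IsingGadget.gadgetMeasure m m ⌊θ * d⌋₊ (d - ⌊θ * d⌋₊)).real
              {ω | IsingGadget.PhasesLikely ω.graph ω.ports (d - ⌊θ * d⌋₊) β
                (1 - 2 * m / Real.exp (δ * |β| * d))} := by
  -- The boundary per vertex is at least `(ρ d / 200) / 2 = 3 * (ρ d / 1200)`, while `d - ⌊θ d⌋` is at
  -- most `2 * (ρ d / 1200)`; half of the excess `ρ d / 1200` is `δ d`.
  refine ⟨1 - ρ / 1200, ρ / 2400, by linarith, by linarith, by positivity, fun m => 4 / m,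
    tendsto_const_div_atTop_nhds_zero_nat 4, ?_⟩
  intro m d hd hdm β hβ
  have hq0 : 1200 ≤ 1200 / ρ := by
    rw [le_div_iff₀ hρ0]; nlinarith
  have hd0 : (1204 : ℝ) ≤ d := by linarith
  have hρd : 1200 ≤ ρ * d := by
    have : 1200 / ρ ≤ d := by linarith
    rw [div_le_iff₀ hρ0] at this
    linarith
  have hm : 0 < m := by
    rcases Nat.eq_zero_or_pos m with rfl | h
    · rw [Nat.cast_zero, Real.zero_rpow (by linarith)] at hdm
      linarith
    · exact h
  have hm1 : (1 : ℝ) ≤ m := by exact_mod_cast hm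
  have hdm' : (d : ℝ) ≤ m := hdm.trans (by
    calc (m : ℝ) ^ (1 - ρ) ≤ (m : ℝ) ^ (1 : ℝ) :=
          Real.rpow_le_rpow_of_exponent_le hm1 (by linarith)
      _ = m := Real.rpow_one _)
  set D := ⌊(1 - ρ / 1200) * (d : ℝ)⌋₊ with hD
  have hDle : (D : ℝ) ≤ (1 - ρ / 1200) * d :=
    Nat.floor_le (mul_nonneg (by linarith) (by linarith))
  have hDge : (1 - ρ / 1200) * (d : ℝ) - 1 < D := by
    have := Nat.lt_floor_add_one ((1 - ρ / 1200) * (d : ℝ))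
    linarith
  have hDd : D ≤ d := by
    have : (D : ℝ) ≤ d := by nlinarith
    exact_mod_cast this
  have hout : ((d - D : ℕ) : ℝ) ≤ 2 * (ρ * d / 1200) := by
    rw [Nat.cast_sub hDd]; linarith
  have hD99 : 0.99 * (d : ℝ) ≤ D := by nlinarith
  classical
  refine IsingGadget.gadgetMeasure_real_ge (bad := fun ω =>
    IsingGadget.HasSparseCut (ρ * d / 200) ω ∨ IsingGadget.HasSparseCut (ρ * d / 200) ω⁻¹) ?_
    (IsingGadget.card_hasSparseCut_or_inv_le hρ0 hρ1 hd hdm (by exact_mod_cast hd0)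
      (by exact_mod_cast hdm') hD99)
  intro ω hω
  rw [not_or] at hω
  have h := IsingGadget.phasesLikely_of_edgeBoundary (G := ω.graph) (k := d - D) hm ω.ports
    (lam := ρ * d / 1200) hβ (IsingGadget.plusPhase_ne_of_adj ω) (by
      intro S hS hSm
      have h1 := IsingGadget.mul_card_le_ncard_edgeBoundary (φ := ρ * d / 200) (by positivity)
        hω.1 hω.2 (IsingGadget.graph_adj_inner ω) hS hSm
      refine le_trans ?_ h1
      gcongr
      linarith)
  have he : ρ * d / 1200 / 2 * |β| = ρ / 2400 * |β| * d := by ring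
  rw [he] at h
  exact h
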